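/- For $n\ge 1$ let $Q_n$ be the linear crossed octagonal-quadrilateral network: the simple graph on the $8n+2$ vertices $1,\dots,4n+1,1',\dots,(4n+1)'$ whose edges are $\{i,i+1\}$, $\{i',(i+1)'\}$, $\{i,(i+1)'\}$, $\{i',i+1\}$ for $1\le i\le 4n$, together with the rungs $\{i,i'\}$ for those $1\le i\le 4n+1$ with $i\equiv 0$ or $1 \pmod 4$. (Without the edges $\{i,(i+1)'\}$ and $\{i',i+1\}$ it is the linear chain of $n$ octagons alternating with $n$ quadrilaterals.) For a connected graph $G$, let $d_u$ be the degree of the vertex $u$, and let $r_{uv}$ be the effective resistance between $u$ and $v$ when every edge of $G$ is a unit resistor, i.e. the potential difference between $u$ and $v$ when a unit current enters at $u$ and leaves at $v$. The degree-Kirchhoff index of $G$ is $Kf^*(G)=\sum_{\{u,v\}} d_u d_v r_{uv}$, the sum being over all unordered pairs of distinct vertices. **Theorem.** For every integer $n\ge 1$, $$Kf^*(Q_n)=\frac{2\,(324n^3+252n^2+71n+2)}{3}.$$ -/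

import Mathlib

open scoped Matrix

noncomputable section

/-- `φ` is an electric potential that sends a unit current into the network `G` at `a` and out of
it at `b`, every edge of `G` being a unit resistor: by Ohm's and Kirchhoff's laws the net current
`∑ y ~ x, (φ x - φ y) = (L(G) φ) x` leaving the vertex `x` is `1` at `a`, `-1` at `b`, and `0`
elsewhere (and `0` everywhere if `a = b`). -/
def IsUnitCurrentPotential {V : Type*} [Fintype V] [DecidableEq V] (G : SimpleGraph V)
    [DecidableRel G.Adj] (a b : V) (φ : V → ℝ) : Prop :=
  G.lapMatrix ℝ *ᵥ φ = Pi.single a 1 - Pi.single b 1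

open Classical in
/-- The resistance distance between `a` and `b`: the potential difference between `a` and `b` when
a unit current flows from `a` to `b`. See `resistanceDistance_eq` and
`exists_isUnitCurrentPotential` below for well-definedness. (The value is `0` by convention when no
such current exists, i.e. when `a` and `b` lie in different components.) -/
def resistanceDistance {V : Type*} [Fintype V] [DecidableEq V] (G : SimpleGraph V)
    [DecidableRel G.Adj] (a b : V) : ℝ :=
  if h : ∃ φ : V → ℝ, IsUnitCurrentPotential G a b φ then h.choose a - h.choose b else 0

/-- The potential difference does not depend on the potential chosen. -/
theorem resistanceDistance_eq {V : Type*} [Fintype V] [DecidableEq V] (G : SimpleGraph V)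
    [DecidableRel G.Adj] {a b : V} {φ : V → ℝ} (hφ : IsUnitCurrentPotential G a b φ) :
    resistanceDistance G a b = φ a - φ b := by
  have h : ∃ φ : V → ℝ, IsUnitCurrentPotential G a b φ := ⟨φ, hφ⟩
  have hψ := h.choose_spec
  rw [resistanceDistance, dif_pos h]
  generalize h.choose = ψ at hψ
  unfold IsUnitCurrentPotential at hφ hψ
  have h1 : ψ ⬝ᵥ (G.lapMatrix ℝ *ᵥ φ) = φ ⬝ᵥ (G.lapMatrix ℝ *ᵥ ψ) := by
    rw [Matrix.dotProduct_mulVec, ← Matrix.mulVec_transpose, (G.isSymm_lapMatrix (R := ℝ)).eq,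
      dotProduct_comm]
  rw [hφ, hψ] at h1
  simpa [dotProduct_sub] using h1

/-- In a connected graph a unit current can flow between any two vertices. -/
theorem exists_isUnitCurrentPotential {V : Type*} [Fintype V] [DecidableEq V] (G : SimpleGraph V)
    [DecidableRel G.Adj] (hG : G.Connected) (a b : V) :
    ∃ φ : V → ℝ, IsUnitCurrentPotential G a b φ := by
  have hne : Nonempty V := ⟨a⟩
  have hcard : (Fintype.card V : ℝ) ≠ 0 := by exact_mod_cast Fintype.card_ne_zero
  have hsum : ∀ φ : V → ℝ, ∑ x, (G.lapMatrix ℝ *ᵥ φ) x = 0 := by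
    intro φ
    have h1 : (fun _ : V => (1 : ℝ)) ⬝ᵥ (G.lapMatrix ℝ *ᵥ φ) = 0 := by
      rw [Matrix.dotProduct_mulVec, ← Matrix.mulVec_transpose, (G.isSymm_lapMatrix (R := ℝ)).eq,
        G.lapMatrix_mulVec_const_eq_zero, zero_dotProduct]
    simpa [dotProduct] using h1
  let T : (V → ℝ) →ₗ[ℝ] (V → ℝ) :=
    { toFun := fun φ => G.lapMatrix ℝ *ᵥ φ + fun _ => ∑ y, φ y
      map_add' := fun φ ψ => by
        ext x
        simp only [Matrix.mulVec_add, Pi.add_apply, Finset.sum_add_distrib]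
        ring
      map_smul' := fun c φ => by
        ext x
        simp only [Matrix.mulVec_smul, Pi.add_apply, Pi.smul_apply, smul_eq_mul, RingHom.id_apply,
          ← Finset.mul_sum]
        ring }
  have key : ∀ φ : V → ℝ, ∑ x, T φ x = 0 → ∑ y, φ y = 0 ∧ T φ = G.lapMatrix ℝ *ᵥ φ := by
    intro φ h
    have h0 : ∑ y, φ y = 0 := by
      have h2 : ∑ x, T φ x
          = ∑ x, (G.lapMatrix ℝ *ᵥ φ) x + Fintype.card V * ∑ y, φ y := by
        simp [T, Finset.sum_add_distrib]
      rw [h, hsum φ, zero_add] at h2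
      exact (mul_eq_zero.mp h2.symm).resolve_left hcard
    refine ⟨h0, ?_⟩
    ext x
    simp [T, h0]
  have hinj : Function.Injective T := by
    rw [injective_iff_map_eq_zero]
    intro φ hφ
    obtain ⟨h0, hT⟩ := key φ (by simp [hφ])
    rw [hφ] at hT
    have hc := (G.lapMatrix_mulVec_eq_zero_iff_forall_reachable (x := φ)).mp hT.symm
    ext x
    have h3 : ∑ y, φ y = Fintype.card V * φ x := by
      rw [Finset.sum_congr rfl fun y _ => hc y x (hG.preconnected y x)]
      simp
    rw [h0] at h3
    exact (mul_eq_zero.mp h3.symm).resolve_left hcard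
  obtain ⟨φ, hφ⟩ := LinearMap.injective_iff_surjective.mp hinj (Pi.single a 1 - Pi.single b 1)
  refine ⟨φ, ?_⟩
  unfold IsUnitCurrentPotential
  rw [← (key φ (by simp [hφ])).2, hφ]

/-- The resistance distance is symmetric. -/
theorem resistanceDistance_comm {V : Type*} [Fintype V] [DecidableEq V] (G : SimpleGraph V)
    [DecidableRel G.Adj] (a b : V) : resistanceDistance G a b = resistanceDistance G b a := by
  have hneg : ∀ (c d : V) (φ : V → ℝ), IsUnitCurrentPotential G c d φ →
      IsUnitCurrentPotential G d c (-φ) := by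
    intro c d φ h
    unfold IsUnitCurrentPotential at *
    rw [Matrix.mulVec_neg, h, neg_sub]
  by_cases h : ∃ φ : V → ℝ, IsUnitCurrentPotential G a b φ
  · obtain ⟨φ, hφ⟩ := h
    rw [resistanceDistance_eq G hφ, resistanceDistance_eq G (hneg a b φ hφ)]
    simp only [Pi.neg_apply]
    ring
  · have h' : ¬ ∃ φ : V → ℝ, IsUnitCurrentPotential G b a φ :=
      fun ⟨φ, hφ⟩ => h ⟨-φ, hneg b a φ hφ⟩
    rw [resistanceDistance, resistanceDistance, dif_neg h, dif_neg h']

/-- The degree-Kirchhoff index: the sum of `deg u * deg v * r(u, v)` over all unordered pairs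
`{u, v}` of distinct vertices. -/
def degreeKirchhoffIndex {V : Type*} [Fintype V] [DecidableEq V] (G : SimpleGraph V)
    [DecidableRel G.Adj] : ℝ :=
  ∑ e ∈ Finset.univ.filter (fun e : Sym2 V => ¬ e.IsDiag),
    Sym2.lift ⟨fun u v => (G.degree u : ℝ) * (G.degree v : ℝ) * resistanceDistance G u v,
      fun u v => by
        beta_reduce
        rw [resistanceDistance_comm G u v, mul_comm (G.degree u : ℝ)]⟩ e

/-- Vertices of the networks with `n` octagons and `n` quadrilaterals: `(i, false)` is the vertex
labelled `i + 1` and `(i, true)` the vertex labelled `(i + 1)'`, for `0 ≤ i ≤ 4 n`. -/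
abbrev OQVertex (n : ℕ) : Type := Fin (4 * n + 1) × Bool

/-- The linear octagonal-quadrilateral network: the two paths `1, 2, …, 4n+1` and
`1', 2', …, (4n+1)'`, together with the rungs `{k, k'}` for the labels `k ≡ 0, 1 (mod 4)`.
The rungs at `4j+1` and `4j+4` bound an octagon, those at `4j+4` and `4j+5` a quadrilateral. -/
def linearOQ (n : ℕ) : SimpleGraph (OQVertex n) where
  Adj u v :=
    (u.2 = v.2 ∧ ((u.1 : ℕ) + 1 = v.1 ∨ (v.1 : ℕ) + 1 = u.1)) ∨
    (u.2 ≠ v.2 ∧ u.1 = v.1 ∧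
      (((u.1 : ℕ) + 1) % 4 = 0 ∨ ((u.1 : ℕ) + 1) % 4 = 1))
  symm := ⟨by
    rintro ⟨i, s⟩ ⟨j, t⟩ (⟨h, h'⟩ | ⟨h, h', h''⟩)
    · exact Or.inl ⟨h.symm, h'.symm⟩
    · simp only at h h' h''
      subst h'
      exact Or.inr ⟨h.symm, rfl, h''⟩⟩
  loopless := ⟨by
    rintro ⟨i, s⟩ (⟨_, h⟩ | ⟨h, _⟩)
    · simp at h
    · exact h rfl⟩

/-- The crossing edges `{k, (k+1)'}` and `{k', k+1}` for `1 ≤ k ≤ 4n`. -/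
def crossingEdges (n : ℕ) : SimpleGraph (OQVertex n) where
  Adj u v := u.2 ≠ v.2 ∧ ((u.1 : ℕ) + 1 = v.1 ∨ (v.1 : ℕ) + 1 = u.1)
  symm := ⟨fun _ _ h => ⟨h.1.symm, h.2.symm⟩⟩
  loopless := ⟨fun _ h => h.1 rfl⟩

/-- The linear crossed octagonal-quadrilateral network `Q_n`. -/
def crossedOQ (n : ℕ) : SimpleGraph (OQVertex n) := linearOQ n ⊔ crossingEdges n

instance (n : ℕ) : DecidableRel (linearOQ n).Adj := fun u v =>
  inferInstanceAs (Decidable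
    ((u.2 = v.2 ∧ ((u.1 : ℕ) + 1 = v.1 ∨ (v.1 : ℕ) + 1 = u.1)) ∨
    (u.2 ≠ v.2 ∧ u.1 = v.1 ∧
      (((u.1 : ℕ) + 1) % 4 = 0 ∨ ((u.1 : ℕ) + 1) % 4 = 1))))

instance (n : ℕ) : DecidableRel (crossingEdges n).Adj := fun u v =>
  inferInstanceAs (Decidable
    (u.2 ≠ v.2 ∧ ((u.1 : ℕ) + 1 = v.1 ∨ (v.1 : ℕ) + 1 = u.1)))

instance (n : ℕ) : DecidableRel (crossedOQ n).Adj := fun u v =>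
  inferInstanceAs (Decidable ((linearOQ n).Adj u v ∨ (crossingEdges n).Adj u v))

/-- `Q_n` is connected, so that all its resistance distances are genuine. -/
theorem crossedOQ_connected (n : ℕ) : (crossedOQ n).Connected := by
  have hr : ∀ (k : ℕ) (hk : k < 4 * n + 1) (s : Bool),
      (crossedOQ n).Reachable (⟨0, by omega⟩, false) (⟨k, hk⟩, s) := by
    intro k
    induction k with
    | zero =>
      intro hk s
      cases s
      · exact SimpleGraph.Reachable.refl _
      · refine SimpleGraph.Adj.reachable (Or.inl (Or.inr ?_))
        simp
    | succ k ih =>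
      intro hk s
      refine (ih (by omega) s).trans (SimpleGraph.Adj.reachable (Or.inl (Or.inl ?_)))
      simp
  have : Nonempty (OQVertex n) := ⟨(⟨0, by omega⟩, false)⟩
  refine SimpleGraph.Connected.mk fun u v => ?_
  exact (hr u.1 u.1.2 u.2).symm.trans (hr v.1 v.1.2 v.2)

end

open Finset

/-! The two vertices of a column have the same neighbours in other columns, so a unit source at one
of them splits into a symmetric and an antisymmetric half. For the symmetric half consecutive
columns are joined by four parallel resistors, which gives `1/4` of resistance per step. The
antisymmetric half does not leave its column: it is an eigenvector of the Laplacian with eigenvalue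
the degree plus the number of rungs there. This yields `resistanceDistance_crossedOQ`.

Summing over the two vertices in each column (`degreeKirchhoffIndex_crossedOQ`) leaves a weighted
sum of `|i - j|` and a product of two single sums. Away from the ends the degrees have period four,
so these sums have polynomial closed forms, proved by adding four columns at a time; the last
column, of degree 3, is added at the end. -/

/-- The degree-Kirchhoff index is half of the sum over all ordered pairs of vertices. -/
theorem degreeKirchhoffIndex_eq_half_sum {V : Type*} [Fintype V] [DecidableEq V]
    (G : SimpleGraph V) [DecidableRel G.Adj] :
    degreeKirchhoffIndex G =
      (∑ u, ∑ v, (G.degree u : ℝ) * (G.degree v : ℝ) * resistanceDistance G u v) / 2 := by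
  have hdiag : ∀ u, resistanceDistance G u u = 0 := fun u => by
    rw [resistanceDistance_eq G (a := u) (b := u) (φ := 0) (by simp [IsUnitCurrentPotential])]
    simp
  rw [eq_div_iff two_ne_zero, ← Fintype.sum_prod_type'
    (f := fun u v => (G.degree u : ℝ) * (G.degree v : ℝ) * resistanceDistance G u v),
    ← Finset.sum_fiberwise (s := univ) (g := fun p : V × V => s(p.1, p.2)),
    degreeKirchhoffIndex, Finset.sum_mul, Finset.sum_filter]
  refine Finset.sum_congr rfl fun e _ => ?_
  induction e using Sym2.ind with
  | _ a b =>
    by_cases hab : a = b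
    · subst hab
      have hf : (univ.filter fun p : V × V => s(p.1, p.2) = s(a, a)) = {(a, a)} := by
        ext ⟨x, y⟩
        simp
      rw [hf]
      simp [hdiag]
    · have hf : (univ.filter fun p : V × V => s(p.1, p.2) = s(a, b)) = {(a, b), (b, a)} := by
        ext ⟨x, y⟩
        simp
      rw [hf, Finset.sum_pair (by simp [hab])]
      simp only [Sym2.mk_isDiag_iff, hab, not_false_eq_true, if_true, Sym2.lift_mk]
      rw [resistanceDistance_comm G b a]
      ring

/-! ### Neighbours and degrees -/

theorem crossedOQ_adj (n : ℕ) (u v : OQVertex n) :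
    (crossedOQ n).Adj u v ↔ (v.1 : ℕ) = u.1 + 1 ∨ (v.1 : ℕ) + 1 = u.1 ∨
      ((v.1 : ℕ) = u.1 ∧ v.2 = !u.2 ∧
        (((u.1 : ℕ) + 1) % 4 = 0 ∨ ((u.1 : ℕ) + 1) % 4 = 1)) := by
  obtain ⟨⟨i, hi⟩, s⟩ := u
  obtain ⟨⟨j, hj⟩, t⟩ := v
  simp only [crossedOQ, SimpleGraph.sup_adj, linearOQ, crossingEdges, Fin.mk.injEq]
  cases s <;> cases t <;> simp <;> omega

theorem sum_neighborFinset_crossedOQ (n : ℕ) (v : OQVertex n) (g : ℕ → Bool → ℝ) :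
    ∑ w ∈ (crossedOQ n).neighborFinset v, g w.1 w.2 =
      (if (v.1 : ℕ) < 4 * n then g (v.1 + 1) true + g (v.1 + 1) false else 0) +
      (if 0 < (v.1 : ℕ) then g (v.1 - 1) true + g (v.1 - 1) false else 0) +
      (if ((v.1 : ℕ) + 1) % 4 = 0 ∨ ((v.1 : ℕ) + 1) % 4 = 1 then g v.1 (!v.2) else 0) := by
  obtain ⟨⟨k, hk⟩, u⟩ := v
  have hsplit : ∀ w : OQVertex n,
      (if (crossedOQ n).Adj (⟨k, hk⟩, u) w then g w.1 w.2 else 0) =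
      (if (w.1 : ℕ) = k + 1 then g w.1 w.2 else 0) +
      -- The guard is needed because truncated subtraction at `k = 0` would point back to column `0`
      -- itself.
      (if 0 < k then if (w.1 : ℕ) = k - 1 then g w.1 w.2 else 0 else 0) +
      (if (k + 1) % 4 = 0 ∨ (k + 1) % 4 = 1 then
        if (w.1 : ℕ) = k then if w.2 = !u then g w.1 w.2 else 0 else 0 else 0) := by
    intro w
    simp only [crossedOQ_adj]
    split_ifs <;> first | (exfalso; omega) | (simp; done) | (exfalso; simp_all)
  rw [SimpleGraph.neighborFinset_eq_filter, Finset.sum_filter, Finset.sum_congr rfl fun w _ =>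
    hsplit w, Fintype.sum_prod_type]
  simp only [Fintype.sum_bool, Finset.sum_add_distrib]
  have hcol : ∀ (m : ℕ) (f : ℕ → ℝ), ∑ x : Fin (4 * n + 1), (if (x : ℕ) = m then f x else 0) =
      if m < 4 * n + 1 then f m else 0 := by
    intro m f
    rw [Fin.sum_univ_eq_sum_range (fun x => if x = m then f x else 0)]
    simp
  have hk' : k - 1 < 4 * n + 1 := by omega
  have hF := fun m => hcol m fun x => g x false
  have hT := fun m => hcol m fun x => g x true
  by_cases h0 : 0 < k <;> by_cases hr : (k + 1) % 4 = 0 ∨ (k + 1) % 4 = 1 <;> cases u <;>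
    simp only [h0, hr, if_true, if_false, Bool.not_false, Bool.not_true, hF, hT, hk, hk',
      Bool.false_eq_true, Bool.true_eq_false, ite_self, Finset.sum_const_zero, add_zero, zero_add,
      Nat.add_lt_add_iff_right] <;>
    split_ifs <;> ring

/-- The degree of the vertices in column `k` of `Q_n`. -/
noncomputable def columnDegree (n k : ℕ) : ℝ :=
  (if k < 4 * n then 2 else 0) + (if 0 < k then 2 else 0) +
    if (k + 1) % 4 = 0 ∨ (k + 1) % 4 = 1 then 1 else 0

/-- The amount that column `k` adds to the resistance from one of its vertices to a vertex of another
column; a quarter of the resistance between its two vertices. -/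
noncomputable def columnExcess (n k : ℕ) : ℝ :=
  1 / (2 * (columnDegree n k + if (k + 1) % 4 = 0 ∨ (k + 1) % 4 = 1 then 1 else 0))

theorem degree_crossedOQ (n : ℕ) (v : OQVertex n) :
    ((crossedOQ n).degree v : ℝ) = columnDegree n v.1 := by
  have h := sum_neighborFinset_crossedOQ n v fun _ _ => 1
  simp only [sum_const, SimpleGraph.card_neighborFinset_eq_degree, nsmul_eq_mul, mul_one] at h
  rw [h, columnDegree]
  norm_num

/-! ### Potentials and resistance distances -/

/-- The potential generated by a unit current entering at `(i, s)` and leaving in equal parts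
through the four end vertices. -/
noncomputable def sourcePotential (n i : ℕ) (s : Bool) (k : ℕ) (u : Bool) : ℝ :=
  -|(k : ℝ) - i| / 8 + if k = i then (if u = s then columnExcess n i else -columnExcess n i) else 0

/-- The antisymmetric part cancels within a column, hence is invisible from the adjacent columns. -/
theorem sourcePotential_add (n i : ℕ) (s : Bool) (k : ℕ) :
    sourcePotential n i s k true + sourcePotential n i s k false = -|(k : ℝ) - i| / 4 := by
  unfold sourcePotential
  cases s <;> by_cases h : k = i <;> simp [h] <;> ring

theorem columnDegree_pos {n : ℕ} (hn : 1 ≤ n) (k : ℕ) : 0 < columnDegree n k := by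
  have h : k < 4 * n ∨ 0 < k := by omega
  unfold columnDegree
  rcases h with h | h <;> simp only [h, if_true] <;> positivity

/-- This is the eigenvector equation: degree plus rungs, times the excess, is the antisymmetric
half-source `1 / 2`. -/
theorem columnExcess_mul {n : ℕ} (hn : 1 ≤ n) (k : ℕ) :
    columnExcess n k * columnDegree n k =
      1 / 2 - if (k + 1) % 4 = 0 ∨ (k + 1) % 4 = 1 then columnExcess n k else 0 := by
  have := columnDegree_pos hn k
  unfold columnExcess
  split_ifs <;> field_simp <;> ring

theorem lapMatrix_mulVec_sourcePotential {n : ℕ} (hn : 1 ≤ n) (a v : OQVertex n) :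
    ((crossedOQ n).lapMatrix ℝ *ᵥ fun w => sourcePotential n a.1 a.2 w.1 w.2) v =
      (Pi.single a 1 : OQVertex n → ℝ) v -
        ((if (v.1 : ℕ) = 0 then 1 / 4 else 0) + if (v.1 : ℕ) = 4 * n then 1 / 4 else 0) := by
  rw [SimpleGraph.lapMatrix_mulVec_apply, degree_crossedOQ,
    sum_neighborFinset_crossedOQ n v (sourcePotential n a.1 a.2), Pi.single_apply]
  obtain ⟨⟨i, hi⟩, s⟩ := a
  obtain ⟨⟨k, hk⟩, u⟩ := v
  simp only [Prod.mk.injEq, Fin.mk.injEq, sourcePotential_add]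
  have hC := columnExcess_mul hn i
  have hpred : 0 < k → ((k - 1 : ℕ) : ℝ) = k - 1 := fun h => by
    rw [Nat.cast_sub (by omega), Nat.cast_one]
  -- Off the source column the potential is linear in `k`, so currents balance except in an end
  -- column, where the missing side produces the drain of `1 / 4`.
  rcases lt_trichotomy k i with h | h | h
  · have h1 : (k : ℝ) + 1 ≤ i := by exact_mod_cast h
    have h2 : k < 4 * n := by omega
    have a0 : |(k : ℝ) - i| = i - k := by rw [abs_of_nonpos (by linarith)]; ring
    have a1 : |((k + 1 : ℕ) : ℝ) - i| = i - k - 1 := by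
      push_cast; rw [abs_of_nonpos (by linarith)]; ring
    have a2 : |(k : ℝ) - 1 - i| = i - k + 1 := by rw [abs_of_nonpos (by linarith)]; ring
    simp only [sourcePotential, columnDegree, h.ne, h2, h2.ne, a0, a1, if_true, if_false, false_and]
    rcases Nat.eq_zero_or_pos k with h0 | h0
    · subst h0
      norm_num
      ring
    · rw [hpred h0, a2]
      simp only [h0, h0.ne', if_true, if_false]
      split_ifs <;> ring
  · subst h
    have a1 : |((k + 1 : ℕ) : ℝ) - k| = 1 := by push_cast; simp
    have a2 : |(k : ℝ) - 1 - k| = 1 := by rw [abs_of_nonpos (by linarith)]; ring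
    -- At the source column the antisymmetric part gives `±1 / 2`, and the kink of the absolute
    -- value (`hends`) gives the other `1 / 2`, up to the drains.
    have hs : columnDegree n k * sourcePotential n k s k u -
        (if (k + 1) % 4 = 0 ∨ (k + 1) % 4 = 1 then sourcePotential n k s k (!u) else 0) =
        if u = s then 1 / 2 else -1 / 2 := by
      simp only [sourcePotential, if_true, sub_self, abs_zero]
      cases u <;> cases s <;>
        simp only [Bool.not_false, Bool.not_true, if_true, if_false, Bool.false_eq_true,
          Bool.true_eq_false] <;>
        split_ifs at hC ⊢ <;> linarith
    have hends : (if k < 4 * n then -|((k + 1 : ℕ) : ℝ) - k| / 4 else 0) +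
        (if 0 < k then -|((k - 1 : ℕ) : ℝ) - k| / 4 else 0) =
        -(1 / 2) + ((if k = 0 then 1 / 4 else 0) + if k = 4 * n then 1 / 4 else 0) := by
      rcases Nat.eq_zero_or_pos k with h0 | h0
      · have h2 : 0 < 4 * n := by omega
        subst h0
        simp only [h2, h2.ne, a1, if_true, if_false, lt_irrefl]
        norm_num
      · rw [hpred h0, a1, a2]
        rcases (Nat.lt_succ_iff.mp hk).lt_or_eq with h2 | h2
        · simp only [h0, h0.ne', h2, h2.ne, if_true, if_false]
          norm_num
        · simp only [h2, lt_irrefl, if_true, if_false]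
          split_ifs <;> first | omega | norm_num
    simp only [true_and]
    rw [hends]
    have hd : (if u = s then (1 : ℝ) / 2 else -1 / 2) + 1 / 2 = if u = s then 1 else 0 := by
      split_ifs <;> norm_num
    linarith
  · have h1 : (i : ℝ) + 1 ≤ k := by exact_mod_cast h
    have h0 : 0 < k := by omega
    have a0 : |(k : ℝ) - i| = k - i := abs_of_nonneg (by linarith)
    have a1 : |((k + 1 : ℕ) : ℝ) - i| = k - i + 1 := by
      push_cast; rw [abs_of_nonneg (by linarith)]; ring
    have a2 : |(k : ℝ) - 1 - i| = k - i - 1 := by rw [abs_of_nonneg (by linarith)]; ring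
    rw [hpred h0, a2]
    simp only [sourcePotential, columnDegree, h.ne', h0, h0.ne', a0, a1, if_true, if_false,
      false_and]
    rcases (Nat.lt_succ_iff.mp hk).lt_or_eq with h2 | h2
    · simp only [h2, h2.ne, if_true, if_false]
      split_ifs <;> ring
    · simp only [h2, lt_irrefl, if_true, if_false]
      split_ifs <;> ring

theorem resistanceDistance_crossedOQ {n : ℕ} (hn : 1 ≤ n) (a b : OQVertex n) :
    resistanceDistance (crossedOQ n) a b =
      |((a.1 : ℕ) : ℝ) - (b.1 : ℕ)| / 4 + columnExcess n a.1 + columnExcess n b.1 -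
        if (a.1 : ℕ) = b.1 then
          (if a.2 = b.2 then 2 * columnExcess n a.1 else -(2 * columnExcess n a.1)) else 0 := by
  -- The drains at the ends do not depend on the source, so they cancel in the difference.
  have h : IsUnitCurrentPotential (crossedOQ n) a b
      ((fun w => sourcePotential n a.1 a.2 w.1 w.2) -
        fun w => sourcePotential n b.1 b.2 w.1 w.2) := by
    unfold IsUnitCurrentPotential
    ext v
    rw [Matrix.mulVec_sub, Pi.sub_apply, Pi.sub_apply, lapMatrix_mulVec_sourcePotential hn,
      lapMatrix_mulVec_sourcePotential hn]
    ring
  rw [resistanceDistance_eq _ h]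
  simp only [Pi.sub_apply, sourcePotential, sub_self, abs_zero]
  rw [abs_sub_comm ((b.1 : ℕ) : ℝ)]
  by_cases h1 : (a.1 : ℕ) = b.1
  · by_cases h2 : a.2 = b.2
    · simp only [h1, h2, if_true]
      ring
    · simp only [h1, h2, Ne.symm h2, if_true, if_false]
      ring
  · simp only [h1, Ne.symm h1, if_true, if_false]
    ring

/-! ### Reduction to sums over columns -/

theorem degreeKirchhoffIndex_crossedOQ {n : ℕ} (hn : 1 ≤ n) :
    degreeKirchhoffIndex (crossedOQ n) =
      (∑ i ∈ range (4 * n + 1), ∑ j ∈ range (4 * n + 1),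
        columnDegree n i * columnDegree n j * |(i : ℝ) - j|) / 2 +
      4 * (∑ i ∈ range (4 * n + 1), columnDegree n i) *
        ∑ i ∈ range (4 * n + 1), columnDegree n i * columnExcess n i := by
  rw [degreeKirchhoffIndex_eq_half_sum]
  have h : ∀ i j : Fin (4 * n + 1), ∑ s : Bool, ∑ t : Bool,
      (((crossedOQ n).degree (i, s) : ℝ) * ((crossedOQ n).degree (j, t) : ℝ) *
        resistanceDistance (crossedOQ n) (i, s) (j, t)) =
      columnDegree n i * columnDegree n j * |((i : ℕ) : ℝ) - (j : ℕ)| +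
        (4 * (columnDegree n j * (columnDegree n i * columnExcess n i)) +
        4 * (columnDegree n i * (columnDegree n j * columnExcess n j))) := by
    intro i j
    simp only [degree_crossedOQ, resistanceDistance_crossedOQ hn, Fintype.sum_bool]
    -- For `i = j` the same-column corrections have opposite signs for equal and for twin vertices,
    -- and cancel over the four pairs.
    by_cases hij : (i : ℕ) = j
    · simp only [hij, if_true, if_false, Bool.true_eq_false, Bool.false_eq_true]
      ring
    · simp only [hij, if_false]
      ring
  simp only [Fintype.sum_prod_type]
  have h' : ∀ i : Fin (4 * n + 1), ∑ s : Bool, ∑ j : Fin (4 * n + 1), ∑ t : Bool,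
      (((crossedOQ n).degree (i, s) : ℝ) * ((crossedOQ n).degree (j, t) : ℝ) *
        resistanceDistance (crossedOQ n) (i, s) (j, t)) = ∑ j : Fin (4 * n + 1),
      (columnDegree n i * columnDegree n j * |((i : ℕ) : ℝ) - (j : ℕ)| +
        (4 * (columnDegree n j * (columnDegree n i * columnExcess n i)) +
        4 * (columnDegree n i * (columnDegree n j * columnExcess n j)))) := fun i => by
    rw [Finset.sum_comm]
    exact Finset.sum_congr rfl fun j _ => h i j
  rw [Finset.sum_congr rfl fun i _ => h' i]
  simp only [Finset.sum_add_distrib, ← Finset.mul_sum, ← Finset.sum_mul]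
  simp only [Finset.sum_range]
  ring

/-! ### Closed forms of the column sums -/

/-- The degree that column `k` has in `Q_n` as long as it is not the last column. -/
noncomputable def innerDegree (k : ℕ) : ℝ :=
  2 + (if 0 < k then 2 else 0) + if (k + 1) % 4 = 0 ∨ (k + 1) % 4 = 1 then 1 else 0

theorem columnDegree_of_lt {n k : ℕ} (h : k < 4 * n) : columnDegree n k = innerDegree k := by
  simp [columnDegree, innerDegree, h]

theorem columnDegree_last {n : ℕ} (hn : 1 ≤ n) : columnDegree n (4 * n) = 3 := by
  have h : (4 * n + 1) % 4 = 1 := by omega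
  have h0 : 0 < 4 * n := by omega
  simp only [columnDegree, h, h0]
  norm_num

/-- A new last column lies to the right of all others, so its absolute values open up and only a
first moment is added; `sum_range_mul_succ_sub` updates that moment in turn. -/
theorem sum_range_abs_sub_succ (f : ℕ → ℝ) (m : ℕ) :
    ∑ i ∈ range (m + 1), ∑ j ∈ range (m + 1), f i * f j * |(i : ℝ) - j| =
      ∑ i ∈ range m, ∑ j ∈ range m, f i * f j * |(i : ℝ) - j| +
        2 * f m * ∑ i ∈ range m, f i * (m - i) := by
  have h1 : ∀ i ∈ range m, f i * f m * |(i : ℝ) - m| = f m * (f i * (m - i)) := fun i hi => by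
    have : (i : ℝ) ≤ m := by exact_mod_cast (mem_range.mp hi).le
    rw [abs_of_nonpos (by linarith)]
    ring
  have h2 : ∀ i ∈ range m, f m * f i * |(m : ℝ) - i| = f m * (f i * (m - i)) := fun i hi => by
    rw [abs_sub_comm, mul_comm (f m) (f i), h1 i hi]
  simp only [Finset.sum_range_succ, Finset.sum_add_distrib]
  rw [Finset.sum_congr rfl h1, Finset.sum_congr rfl h2, ← Finset.mul_sum]
  simp
  ring

theorem sum_range_mul_succ_sub (f : ℕ → ℝ) (m : ℕ) :
    ∑ i ∈ range (m + 1), f i * (((m + 1 : ℕ) : ℝ) - i) =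
      ∑ i ∈ range m, f i * (m - i) + ∑ i ∈ range m, f i + f m := by
  rw [Finset.sum_range_succ, ← Finset.sum_add_distrib]
  congr 1
  · refine Finset.sum_congr rfl fun i _ => ?_
    push_cast
    ring
  · push_cast
    ring

/-- Column `0` has no left neighbours and breaks the period, so the inductions below start from `n =
1`. -/
theorem innerDegree_period {n : ℕ} (hn : 1 ≤ n) :
    innerDegree (4 * n) = 5 ∧ innerDegree (4 * n + 1) = 4 ∧ innerDegree (4 * n + 1 + 1) = 4 ∧
      innerDegree (4 * n + 1 + 1 + 1) = 5 := by
  have h0 : 0 < 4 * n := by omega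
  have m0 : (4 * n + 1) % 4 = 1 := by omega
  have m1 : (4 * n + 1 + 1) % 4 = 2 := by omega
  have m2 : (4 * n + 1 + 1 + 1) % 4 = 3 := by omega
  have m3 : (4 * n + 1 + 1 + 1 + 1) % 4 = 0 := by omega
  refine ⟨?_, ?_, ?_, ?_⟩ <;> simp only [innerDegree, h0, m0, m1, m2, m3] <;> norm_num

theorem sum_range_innerDegree {n : ℕ} (hn : 1 ≤ n) :
    ∑ i ∈ range (4 * n), innerDegree i = 18 * n - 2 := by
  induction n, hn using Nat.le_induction with
  | base => norm_num [Finset.sum_range_succ, innerDegree]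
  | succ n hn ih =>
    obtain ⟨e0, e1, e2, e3⟩ := innerDegree_period hn
    rw [show 4 * (n + 1) = 4 * n + 1 + 1 + 1 + 1 by ring]
    simp only [Finset.sum_range_succ, ih, e0, e1, e2, e3]
    push_cast
    ring

theorem sum_range_innerDegree_mul_sub {n : ℕ} (hn : 1 ≤ n) :
    ∑ i ∈ range (4 * n), innerDegree i * (((4 * n : ℕ) : ℝ) - i) = 36 * n ^ 2 + n := by
  induction n, hn using Nat.le_induction with
  | base => norm_num [Finset.sum_range_succ, innerDegree]
  | succ n hn ih =>
    obtain ⟨e0, e1, e2, e3⟩ := innerDegree_period hn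
    rw [show 4 * (n + 1) = 4 * n + 1 + 1 + 1 + 1 by ring]
    rw [sum_range_mul_succ_sub, sum_range_mul_succ_sub, sum_range_mul_succ_sub,
      sum_range_mul_succ_sub, Finset.sum_range_succ _ (4 * n + 1 + 1),
      Finset.sum_range_succ _ (4 * n + 1), Finset.sum_range_succ _ (4 * n), ih,
      sum_range_innerDegree hn, e0, e1, e2, e3]
    push_cast
    ring

theorem sum_range_innerDegree_mul_abs_sub {n : ℕ} (hn : 1 ≤ n) :
    ∑ i ∈ range (4 * n), ∑ j ∈ range (4 * n), innerDegree i * innerDegree j * |(i : ℝ) - j| =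
      432 * n ^ 3 - 144 * n ^ 2 + 26 * n := by
  induction n, hn using Nat.le_induction with
  | base =>
    rw [show 4 * 1 = 3 + 1 from rfl]
    simp only [sum_range_abs_sub_succ]
    norm_num [Finset.sum_range_succ, innerDegree]
  | succ n hn ih =>
    obtain ⟨e0, e1, e2, e3⟩ := innerDegree_period hn
    rw [show 4 * (n + 1) = 4 * n + 1 + 1 + 1 + 1 by ring]
    rw [sum_range_abs_sub_succ, sum_range_abs_sub_succ, sum_range_abs_sub_succ,
      sum_range_abs_sub_succ, ih, sum_range_mul_succ_sub _ (4 * n + 1 + 1),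
      sum_range_mul_succ_sub _ (4 * n + 1), sum_range_mul_succ_sub _ (4 * n),
      sum_range_innerDegree_mul_sub hn, Finset.sum_range_succ _ (4 * n + 1),
      Finset.sum_range_succ _ (4 * n), sum_range_innerDegree hn, e0, e1, e2, e3]
    push_cast
    ring

/-- The ratio of the degree to twice the degree plus twice the number of rungs, for a column that is
not the last one. -/
noncomputable def innerRatio (k : ℕ) : ℝ :=
  innerDegree k *
    (1 / (2 * (innerDegree k + if (k + 1) % 4 = 0 ∨ (k + 1) % 4 = 1 then 1 else 0)))

theorem sum_range_innerRatio {n : ℕ} (hn : 1 ≤ n) :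
    ∑ i ∈ range (4 * n), innerRatio i = 11 * n / 6 - 1 / 24 := by
  induction n, hn using Nat.le_induction with
  | base => norm_num [Finset.sum_range_succ, innerRatio, innerDegree]
  | succ n hn ih =>
    obtain ⟨e0, e1, e2, e3⟩ := innerDegree_period hn
    have m0 : (4 * n + 1) % 4 = 1 := by omega
    have m1 : (4 * n + 1 + 1) % 4 = 2 := by omega
    have m2 : (4 * n + 1 + 1 + 1) % 4 = 3 := by omega
    have m3 : (4 * n + 1 + 1 + 1 + 1) % 4 = 0 := by omega
    rw [show 4 * (n + 1) = 4 * n + 1 + 1 + 1 + 1 by ring]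
    simp only [Finset.sum_range_succ, ih]
    simp only [innerRatio, e0, e1, e2, e3, m0, m1, m2, m3]
    push_cast
    norm_num
    ring

theorem theorem4p2 (n : ℕ) (hn : 1 ≤ n) :
    degreeKirchhoffIndex (crossedOQ n) =
      2 * (324 * (n : ℝ) ^ 3 + 252 * (n : ℝ) ^ 2 + 71 * (n : ℝ) + 2) / 3 := by
  have hE : ∀ i ∈ range (4 * n), columnDegree n i = innerDegree i := fun i hi =>
    columnDegree_of_lt (mem_range.mp hi)
  have hlast := columnDegree_last hn
  have hT : ∑ i ∈ range (4 * n), columnDegree n i * (((4 * n : ℕ) : ℝ) - i) = 36 * n ^ 2 + n := by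
    rw [← sum_range_innerDegree_mul_sub hn]
    exact Finset.sum_congr rfl fun i hi => by rw [hE i hi]
  have hW : ∑ i ∈ range (4 * n), ∑ j ∈ range (4 * n),
      columnDegree n i * columnDegree n j * |(i : ℝ) - j| =
      432 * n ^ 3 - 144 * n ^ 2 + 26 * n := by
    rw [← sum_range_innerDegree_mul_abs_sub hn]
    exact Finset.sum_congr rfl fun i hi => Finset.sum_congr rfl fun j hj => by
      rw [hE i hi, hE j hj]
  have hX : ∑ i ∈ range (4 * n), columnDegree n i * columnExcess n i = 11 * n / 6 - 1 / 24 := by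
    rw [← sum_range_innerRatio hn]
    exact Finset.sum_congr rfl fun i hi => by rw [columnExcess, hE i hi, innerRatio]
  have hc : columnExcess n (4 * n) = 1 / 8 := by
    have h : (4 * n + 1) % 4 = 1 := by omega
    rw [columnExcess, hlast, h]
    norm_num
  rw [degreeKirchhoffIndex_crossedOQ hn, sum_range_abs_sub_succ, Finset.sum_range_succ _ (4 * n),
    Finset.sum_range_succ _ (4 * n), hT, hW, hX, hlast, hc, Finset.sum_congr rfl hE,
    sum_range_innerDegree hn]
  ring
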